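/- Let $\mathbb{F}$ be an algebraically closed field of characteristic zero. For $f_2,f_3\in\mathbb{F}[x,y]$ let $\Gamma_{\mathbb{F}}(f_2,f_3)$ be the bipartite graph whose vertex set is the disjoint union of two copies $P$ and $L$ of $\mathbb{F}^3$, where $(p_1,p_2,p_3)\in P$ is adjacent to $[l_1,l_2,l_3]\in L$ if and only if $p_2+l_2=f_2(p_1,l_1)$ and $p_3+l_3=f_3(p_1,l_1)$. Put $\Gamma_3(\mathbb{F})=\Gamma_{\mathbb{F}}(xy,x^2y)$ and, for $a\in\mathbb{F}$, $\rho_a(x)=x(x-a)$. A graph is said to have girth at least eight if it contains no cycle of length less than $8$. Let $f,g\in\mathbb{F}[x]$ be monic polynomials with $f(0)=g(0)=0$, let $h(x,y)=\sum_{i,j\geq 1}h_{i,j}x^iy^j\in\mathbb{F}[x,y]$ be a nonzero polynomial, and let $G=\Gamma_{\mathbb{F}}(f(x)g(y),h(x,y))$. If $G$ has girth at least eight, then $G$ is isomorphic to $\Gamma_3(\mathbb{F})$. Furthermore, $G$ has girth at least eight if and only if there are $a\in\mathbb{F}$ and $\zeta\in\mathbb{F}\setminus\{0\}$ such that one of the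 following holds: (i) $f(x)=\rho_a(x)$, $g(y)=y$ and $h(x,y)=\zeta xy+h_{2,1}\rho_a(x)y$; (ii) $f(x)=x$, $g(y)=\rho_a(y)$ and $h(x,y)=\zeta xy+h_{1,2}x\rho_a(y)$; (iii) $f(x)=x$, $g(y)=y$ and $h(x,y)=\zeta\rho_a(x)y$ or $h(x,y)=\zeta x\rho_a(y)$. -/

import Mathlib

open Polynomial
open scoped Polynomial.Bivariate

/-! In `F[X][Y]` the outer variable `Y` plays the role of `y` and the inner variable `X` that of
`x`, so the coefficient `h_{i,j}` of `x ^ i * y ^ j` in `h` is `(h.coeff j).coeff i`, and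
`h.evalEval a b` is `h(a, b)`. -/

/-- The coefficient `h_{i,j}` of `x ^ i * y ^ j` in the bivariate polynomial `h`. -/
noncomputable def biCoeff {F : Type*} [Field F] (h : F[X][Y]) (i j : ℕ) : F :=
  (h.coeff j).coeff i

/-- The univariate polynomial `f`, written in the variable `x`: the bivariate polynomial `f(x)`. -/
noncomputable def inX {F : Type*} [Field F] (f : F[X]) : F[X][Y] :=
  C f

/-- The univariate polynomial `g`, written in the variable `y`: the bivariate polynomial `g(y)`. -/
noncomputable def inY {F : Type*} [Field F] (g : F[X]) : F[X][Y] :=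
  g.map C

/-- The scalar `c` as a constant bivariate polynomial. -/
noncomputable def biConst {F : Type*} [Field F] (c : F) : F[X][Y] :=
  C (C c)

/-- The polynomial `ρ_a = X (X - a)`. -/
noncomputable def rho {F : Type*} [Field F] (a : F) : F[X] :=
  X * (X - C a)

/-- Incidence of the point `(p₁, p₂, p₃)` and the line `[l₁, l₂, l₃]` for the pair `(f₂, f₃)`:
`p₂ + l₂ = f₂(p₁, l₁)` and `p₃ + l₃ = f₃(p₁, l₁)`. -/
def Incident {F : Type*} [Field F] (f₂ f₃ : F[X][Y]) (p l : F × F × F) : Prop :=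
  p.2.1 + l.2.1 = f₂.evalEval p.1 l.1 ∧ p.2.2 + l.2.2 = f₃.evalEval p.1 l.1

/-- The bipartite graph `Γ_F(f₂, f₃)`. Its vertex set is the disjoint union of two copies of `F³`,
the points (`Sum.inl`) and the lines (`Sum.inr`). -/
def GammaGraph {F : Type*} [Field F] (f₂ f₃ : F[X][Y]) :
    SimpleGraph ((F × F × F) ⊕ (F × F × F)) where
  Adj
    | Sum.inl p, Sum.inr l => Incident f₂ f₃ p l
    | Sum.inr l, Sum.inl p => Incident f₂ f₃ p l
    | _, _ => False
  symm := ⟨by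
    rintro (p | l) (p' | l') hadj
    · exact hadj
    · exact hadj
    · exact hadj
    · exact hadj⟩
  loopless := ⟨by
    rintro (p | l) hadj
    · exact hadj
    · exact hadj⟩

/-- The graph `Γ₃(F) = Γ_F(x y, x² y)`. -/
noncomputable def Gamma3 (F : Type*) [Field F] :
    SimpleGraph ((F × F × F) ⊕ (F × F × F)) :=
  GammaGraph (inX X * inY X : F[X][Y]) (inX (X ^ 2) * inY X)

/-! A neighbour of a given vertex is determined by its first coordinate. So a 4-cycle or 6-cycle
amounts to distinct first coordinates at which the alternating sums of both defining functions
vanish, and bipartiteness excludes odd cycles. `NoShortCycle` records this and replaces girth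
throughout.

Sufficiency and the isomorphism come together: in each listed form, after exchanging points and
lines if needed, the two functions are an invertible linear combination of `x y` and `x² y`, and for
that pair the alternating sums factor.

Necessity rests on two devices. The first is fibres: in characteristic zero a nonconstant polynomial
of degree `d` has a fibre with `d` points. If `f(a) = f(b)`, then `h(a, y) - h(b, y)` must be
injective in `y`, hence linear (`evalEval_sub_of_eval_eq`). This forces one of `f`, `g` to be
linear, and the other to have degree at most two. The second is scaling: for `g = y`, a hexagon for
`f(x) y` stays one when its `y`-coordinates are multiplied by `z`. The sum of `h` over it is a
polynomial in `z` without nonzero roots, hence a monomial, so at most one `hexagonCoeff` is nonzero.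
For `f = ρ_a`, the reflection `x ↦ a - x` leaves only `h = p(x) y`. For `f = x`, all terms of `h`
other than `x y` share one `y`-degree and, by symmetry, one `x`-degree; explicit hexagons exclude
`x^m y^n` with `m, n ≥ 2`. A three-point fibre of `p` then bounds its degree by two. -/

/-- No configuration of coordinates `x`, `y` gives rise to a cycle of length four or six in the
graph defined by the pair of functions `φ`, `ψ`. -/
structure NoShortCycle {F : Type*} [Field F] (φ ψ : F → F → F) : Prop where
  four : ∀ x₁ x₂ y₁ y₂, x₁ ≠ x₂ → y₁ ≠ y₂ →
    φ x₁ y₁ - φ x₂ y₁ + φ x₂ y₂ - φ x₁ y₂ = 0 →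
    ψ x₁ y₁ - ψ x₂ y₁ + ψ x₂ y₂ - ψ x₁ y₂ = 0 → False
  six : ∀ x₁ x₂ x₃ y₁ y₂ y₃, x₁ ≠ x₂ → x₂ ≠ x₃ → x₁ ≠ x₃ → y₁ ≠ y₂ → y₂ ≠ y₃ → y₁ ≠ y₃ →
    φ x₁ y₁ - φ x₂ y₁ + φ x₂ y₂ - φ x₃ y₂ + φ x₃ y₃ - φ x₁ y₃ = 0 →
    ψ x₁ y₁ - ψ x₂ y₁ + ψ x₂ y₂ - ψ x₃ y₂ + ψ x₃ y₃ - ψ x₁ y₃ = 0 → False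

theorem NoShortCycle.swap {F : Type*} [Field F] {φ ψ : F → F → F} (H : NoShortCycle φ ψ) :
    NoShortCycle (fun x y => φ y x) (fun x y => ψ y x) where
  four x₁ x₂ y₁ y₂ hx hy h₁ h₂ :=
    H.four y₁ y₂ x₁ x₂ hy hx (by linear_combination h₁) (by linear_combination h₂)
  six x₁ x₂ x₃ y₁ y₂ y₃ a b c a' b' c' h₁ h₂ :=
    H.six y₁ y₃ y₂ x₁ x₃ x₂ c' b'.symm a' c b.symm a
      (by linear_combination h₁) (by linear_combination h₂)

/-! ### Short cycles and alternating sums. -/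

section

variable {F : Type*} [Field F] {f₂ f₃ : F[X][Y]}

theorem Incident.fst_ne {p q l : F × F × F} (hp : Incident f₂ f₃ p l) (hq : Incident f₂ f₃ q l)
    (hne : p ≠ q) : p.1 ≠ q.1 := by
  intro h
  apply hne
  obtain ⟨h₁, h₂⟩ := hp
  obtain ⟨h₃, h₄⟩ := hq
  rw [h] at h₁ h₂
  exact Prod.ext h (Prod.ext (by linear_combination h₁ - h₃) (by linear_combination h₂ - h₄))

theorem Incident.fst_ne' {p l m : F × F × F} (hl : Incident f₂ f₃ p l) (hm : Incident f₂ f₃ p m)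
    (hne : l ≠ m) : l.1 ≠ m.1 := by
  intro h
  apply hne
  obtain ⟨h₁, h₂⟩ := hl
  obtain ⟨h₃, h₄⟩ := hm
  rw [h] at h₁ h₂
  exact Prod.ext h (Prod.ext (by linear_combination h₁ - h₃) (by linear_combination h₂ - h₄))

theorem NoShortCycle.not_quadrangle
    (H : NoShortCycle (fun x y => f₂.evalEval x y) (fun x y => f₃.evalEval x y))
    {p q l m : F × F × F} (h₁ : Incident f₂ f₃ p l) (h₂ : Incident f₂ f₃ q l)
    (h₃ : Incident f₂ f₃ q m) (h₄ : Incident f₂ f₃ p m) (hpq : p ≠ q) (hlm : l ≠ m) : False :=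
  H.four p.1 q.1 l.1 m.1 (h₁.fst_ne h₂ hpq) (h₂.fst_ne' h₃ hlm)
    (by linear_combination -h₁.1 + h₂.1 - h₃.1 + h₄.1)
    (by linear_combination -h₁.2 + h₂.2 - h₃.2 + h₄.2)

theorem NoShortCycle.not_hexagon
    (H : NoShortCycle (fun x y => f₂.evalEval x y) (fun x y => f₃.evalEval x y))
    {p q r l m n : F × F × F} (h₁ : Incident f₂ f₃ p l) (h₂ : Incident f₂ f₃ q l)
    (h₃ : Incident f₂ f₃ q m) (h₄ : Incident f₂ f₃ r m) (h₅ : Incident f₂ f₃ r n)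
    (h₆ : Incident f₂ f₃ p n) (hpq : p ≠ q) (hqr : q ≠ r) (hpr : p ≠ r) (hlm : l ≠ m)
    (hmn : m ≠ n) (hln : l ≠ n) : False :=
  H.six p.1 q.1 r.1 l.1 m.1 n.1 (h₁.fst_ne h₂ hpq) (h₃.fst_ne h₄ hqr) (h₆.fst_ne h₅ hpr)
    (h₂.fst_ne' h₃ hlm) (h₄.fst_ne' h₅ hmn) (h₁.fst_ne' h₆ hln)
    (by linear_combination -h₁.1 + h₂.1 - h₃.1 + h₄.1 - h₅.1 + h₆.1)
    (by linear_combination -h₁.2 + h₂.2 - h₃.2 + h₄.2 - h₅.2 + h₆.2)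

open SimpleGraph in
theorem NoShortCycle.le_egirth
    (H : NoShortCycle (fun x y => f₂.evalEval x y) (fun x y => f₃.evalEval x y)) :
    8 ≤ (GammaGraph f₂ f₃).egirth := by
  rw [SimpleGraph.le_egirth]
  intro a w hw
  by_contra! hlt
  have hlt : w.length < 8 := by exact_mod_cast hlt
  have h3 := hw.three_le_length
  have hnd := hw.support_nodup
  clear hw
  match w, hlt, h3, hnd with
  | .cons (v := b) h₁ (.cons (v := c) h₂ (.cons h₃ .nil)), _, _, hnd =>
    rcases a with a | a <;> rcases b with b | b <;> rcases c with c | c <;>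
      first | exact h₁ | exact h₂ | exact h₃
  | .cons (v := b) h₁ (.cons (v := c) h₂ (.cons (v := d) h₃ (.cons h₄ .nil))), _, _, hnd =>
    rcases a with a | a <;> rcases b with b | b <;> first | exact h₁.elim | skip
    all_goals rcases c with c | c <;> first | exact h₂.elim | skip
    all_goals rcases d with d | d <;> first | exact h₃.elim | skip
    all_goals simp at hnd
    · exact H.not_quadrangle h₁ h₂ h₃ h₄ (by tauto) (by tauto)
    -- The walk starts at a line; rotating it by one step makes it start at a point.
    · exact H.not_quadrangle h₂ h₃ h₄ h₁ (by tauto) (by tauto)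
  | .cons (v := b) h₁ (.cons (v := c) h₂ (.cons (v := d) h₃ (.cons (v := e) h₄
      (.cons h₅ .nil)))), _, _, hnd =>
    rcases a with a | a <;> rcases b with b | b <;> first | exact h₁.elim | skip
    all_goals rcases c with c | c <;> first | exact h₂.elim | skip
    all_goals rcases d with d | d <;> first | exact h₃.elim | skip
    all_goals rcases e with e | e <;> first | exact h₄.elim | exact h₅.elim
  | .cons (v := b) h₁ (.cons (v := c) h₂ (.cons (v := d) h₃ (.cons (v := e) h₄
      (.cons (v := k) h₅ (.cons h₆ .nil))))), _, _, hnd =>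
    rcases a with a | a <;> rcases b with b | b <;> first | exact h₁.elim | skip
    all_goals rcases c with c | c <;> first | exact h₂.elim | skip
    all_goals rcases d with d | d <;> first | exact h₃.elim | skip
    all_goals rcases e with e | e <;> first | exact h₄.elim | skip
    all_goals rcases k with k | k <;> first | exact h₅.elim | skip
    all_goals simp at hnd
    · exact H.not_hexagon h₁ h₂ h₃ h₄ h₅ h₆ (by tauto) (by tauto) (by tauto) (by tauto)
        (by tauto) (by tauto)
    · exact H.not_hexagon h₂ h₃ h₄ h₅ h₆ h₁ (by tauto) (by tauto) (by tauto) (by tauto)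
        (by tauto) (by tauto)
  | .cons (v := b) h₁ (.cons (v := c) h₂ (.cons (v := d) h₃ (.cons (v := e) h₄
      (.cons (v := k) h₅ (.cons (v := m) h₆ (.cons h₇ .nil)))))), _, _, hnd =>
    rcases a with a | a <;> rcases b with b | b <;> first | exact h₁.elim | skip
    all_goals rcases c with c | c <;> first | exact h₂.elim | skip
    all_goals rcases d with d | d <;> first | exact h₃.elim | skip
    all_goals rcases e with e | e <;> first | exact h₄.elim | skip
    all_goals rcases k with k | k <;> first | exact h₅.elim | skip
    all_goals rcases m with m | m <;> first | exact h₆.elim | exact h₇.elim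
  | .cons _ (.cons _ (.cons _ (.cons _ (.cons _ (.cons _ (.cons _ (.cons _ w))))))), hlt, _, _ =>
    simp at hlt
    omega

open SimpleGraph in
-- Starting from `(x₁, 0, 0)`, each further vertex is obtained by solving the incidence equations;
-- the vanishing alternating sums are exactly what the one remaining edge requires.
theorem noShortCycle_of_le_egirth (H : 8 ≤ (GammaGraph f₂ f₃).egirth) :
    NoShortCycle (fun x y => f₂.evalEval x y) (fun x y => f₃.evalEval x y) := by
  rw [SimpleGraph.le_egirth] at H
  constructor
  · intro x₁ x₂ y₁ y₂ hx hy e₁ e₂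
    let φ := fun x y => f₂.evalEval x y
    let ψ := fun x y => f₃.evalEval x y
    let l₁ : F × F × F := (y₁, φ x₁ y₁, ψ x₁ y₁)
    let p₂ : F × F × F := (x₂, φ x₂ y₁ - φ x₁ y₁, ψ x₂ y₁ - ψ x₁ y₁)
    let l₂ : F × F × F := (y₂, φ x₁ y₂, ψ x₁ y₂)
    have h₁ : (GammaGraph f₂ f₃).Adj (Sum.inl (x₁, 0, 0)) (Sum.inr l₁) :=
      ⟨by simp [l₁, φ], by simp [l₁, ψ]⟩
    have h₂ : (GammaGraph f₂ f₃).Adj (Sum.inr l₁) (Sum.inl p₂) :=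
      ⟨by simp [l₁, p₂, φ], by simp [l₁, p₂, ψ]⟩
    have h₃ : (GammaGraph f₂ f₃).Adj (Sum.inl p₂) (Sum.inr l₂) :=
      ⟨by simp only [l₂, p₂, φ]; linear_combination -e₁,
        by simp only [l₂, p₂, ψ]; linear_combination -e₂⟩
    have h₄ : (GammaGraph f₂ f₃).Adj (Sum.inr l₂) (Sum.inl (x₁, 0, 0)) :=
      ⟨by simp [l₂, φ], by simp [l₂, ψ]⟩
    have := H _ (.cons h₁ (.cons h₂ (.cons h₃ (.cons h₄ .nil)))) (by
      simp [Walk.cons_isCycle_iff, l₁, p₂, l₂, hx, hy, hx.symm])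
    simp at this
    exact absurd this (by norm_num)
  · intro x₁ x₂ x₃ y₁ y₂ y₃ a b c a' b' c' e₁ e₂
    let φ := fun x y => f₂.evalEval x y
    let ψ := fun x y => f₃.evalEval x y
    let l₁ : F × F × F := (y₁, φ x₁ y₁, ψ x₁ y₁)
    let p₂ : F × F × F := (x₂, φ x₂ y₁ - φ x₁ y₁, ψ x₂ y₁ - ψ x₁ y₁)
    let l₂ : F × F × F := (y₂, φ x₂ y₂ - (φ x₂ y₁ - φ x₁ y₁), ψ x₂ y₂ - (ψ x₂ y₁ - ψ x₁ y₁))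
    let p₃ : F × F × F := (x₃, φ x₃ y₃ - φ x₁ y₃, ψ x₃ y₃ - ψ x₁ y₃)
    let l₃ : F × F × F := (y₃, φ x₁ y₃, ψ x₁ y₃)
    have h₁ : (GammaGraph f₂ f₃).Adj (Sum.inl (x₁, 0, 0)) (Sum.inr l₁) :=
      ⟨by simp [l₁, φ], by simp [l₁, ψ]⟩
    have h₂ : (GammaGraph f₂ f₃).Adj (Sum.inr l₁) (Sum.inl p₂) :=
      ⟨by simp [l₁, p₂, φ], by simp [l₁, p₂, ψ]⟩
    have h₃ : (GammaGraph f₂ f₃).Adj (Sum.inl p₂) (Sum.inr l₂) :=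
      ⟨by simp [l₂, p₂, φ], by simp [l₂, p₂, ψ]⟩
    have h₄ : (GammaGraph f₂ f₃).Adj (Sum.inr l₂) (Sum.inl p₃) :=
      ⟨by simp only [l₂, p₃, φ]; linear_combination e₁,
        by simp only [l₂, p₃, ψ]; linear_combination e₂⟩
    have h₅ : (GammaGraph f₂ f₃).Adj (Sum.inl p₃) (Sum.inr l₃) :=
      ⟨by simp [l₃, p₃, φ], by simp [l₃, p₃, ψ]⟩
    have h₆ : (GammaGraph f₂ f₃).Adj (Sum.inr l₃) (Sum.inl (x₁, 0, 0)) :=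
      ⟨by simp [l₃, φ], by simp [l₃, ψ]⟩
    have := H _ (.cons h₁ (.cons h₂ (.cons h₃ (.cons h₄ (.cons h₅ (.cons h₆ .nil)))))) (by
      simp [Walk.cons_isCycle_iff, l₁, p₂, l₂, p₃, l₃, a, b, c, a.symm, c.symm,
        a', b', c'])
    simp at this
    exact absurd this (by norm_num)

/-! ### Isomorphisms between the graphs. -/

/-- Exchanging points and lines. -/
def gammaGraphSwapIso {g₂ g₃ : F[X][Y]} (h₂ : ∀ x y, f₂.evalEval x y = g₂.evalEval y x)
    (h₃ : ∀ x y, f₃.evalEval x y = g₃.evalEval y x) : GammaGraph f₂ f₃ ≃g GammaGraph g₂ g₃ where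
  toEquiv := Equiv.sumComm _ _
  map_rel_iff' := by
    have key : ∀ p l : F × F × F, Incident g₂ g₃ l p ↔ Incident f₂ f₃ p l := by
      intro p l
      simp only [Incident, h₂, h₃, add_comm]
    rintro (p | p) (q | q)
    · exact Iff.rfl
    · exact key p q
    · exact key q p
    · exact Iff.rfl

/-- An invertible linear substitution in the last two coordinates. -/
def gammaGraphLinearIso {g₂ g₃ : F[X][Y]} (α β γ δ : F) (hdet : α * δ - β * γ ≠ 0)
    (h₂ : ∀ x y, g₂.evalEval x y = α * f₂.evalEval x y + β * f₃.evalEval x y)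
    (h₃ : ∀ x y, g₃.evalEval x y = γ * f₂.evalEval x y + δ * f₃.evalEval x y) :
    GammaGraph f₂ f₃ ≃g GammaGraph g₂ g₃ where
  toEquiv :=
    let e : F × F × F ≃ F × F × F :=
      { toFun := fun p => (p.1, α * p.2.1 + β * p.2.2, γ * p.2.1 + δ * p.2.2)
        invFun := fun p => (p.1, (δ * p.2.1 - β * p.2.2) / (α * δ - β * γ),
          (α * p.2.2 - γ * p.2.1) / (α * δ - β * γ))
        left_inv := fun p => by
          refine Prod.ext rfl (Prod.ext ?_ ?_) <;> dsimp only <;> rw [div_eq_iff hdet] <;> ring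
        right_inv := fun p => by
          refine Prod.ext rfl (Prod.ext ?_ ?_) <;> dsimp only <;>
            rw [mul_div_assoc', mul_div_assoc', ← add_div, div_eq_iff hdet] <;> ring }
    Equiv.sumCongr e e
  map_rel_iff' := by
    have key : ∀ p l : F × F × F,
        Incident g₂ g₃ (p.1, α * p.2.1 + β * p.2.2, γ * p.2.1 + δ * p.2.2)
          (l.1, α * l.2.1 + β * l.2.2, γ * l.2.1 + δ * l.2.2) ↔ Incident f₂ f₃ p l := by
      intro p l
      simp only [Incident, h₂, h₃]
      constructor
      · rintro ⟨e₁, e₂⟩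
        constructor
        · apply mul_left_cancel₀ hdet
          linear_combination δ * e₁ - β * e₂
        · apply mul_left_cancel₀ hdet
          linear_combination α * e₂ - γ * e₁
      · rintro ⟨e₁, e₂⟩
        exact ⟨by linear_combination α * e₁ + β * e₂, by linear_combination γ * e₁ + δ * e₂⟩
    rintro (p | p) (q | q)
    · exact Iff.rfl
    · exact key p q
    · exact key q p
    · exact Iff.rfl

end

/-! ### Fibres and roots of univariate polynomials. -/

theorem eval_eq_of_natDegree_le_one {K : Type*} [Field K] {p : K[X]} (hp : p.natDegree ≤ 1) (h0 : p.eval 0 = 0) (x : K) :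
    p.eval x = p.coeff 1 * x := by
  rw [eq_X_add_C_of_natDegree_le_one hp] at h0 ⊢
  simp_all

section Univariate

variable {K : Type*} [Field K] [IsAlgClosed K]

/-- In characteristic zero a nonconstant polynomial attains some value at as many points as its
degree allows. -/
theorem exists_card_fiber_eq_natDegree [CharZero K] {p : K[X]} (hp : 1 ≤ p.natDegree) :
    ∃ s : Finset K, s.card = p.natDegree ∧ ∃ c, ∀ x ∈ s, p.eval x = c := by
  classical
  -- The value `c` avoids the finitely many critical values of `p`, so `p - c` has only simple
  -- roots.
  obtain ⟨c, hc⟩ := Infinite.exists_notMem_finset (p.derivative.roots.toFinset.image (p.eval ·))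
  have hdeg : (p - C c).natDegree = p.natDegree := natDegree_sub_C
  have hne : p - C c ≠ 0 := by
    intro h
    rw [h, natDegree_zero] at hdeg
    omega
  have hd : p.derivative ≠ 0 := by
    intro h
    have := derivative_eq_zero.1 h
    omega
  have hnd : (p - C c).roots.Nodup := by
    rw [Multiset.nodup_iff_count_le_one]
    intro a
    rw [count_roots]
    by_contra! hlt
    have hroot := (one_lt_rootMultiplicity_iff_isRoot hne).1 hlt
    apply hc
    rw [Finset.mem_image]
    refine ⟨a, ?_, ?_⟩
    · rw [Multiset.mem_toFinset, mem_roots hd]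
      simpa using hroot.2
    · simpa [sub_eq_zero] using hroot.1
  refine ⟨(p - C c).roots.toFinset, ?_, c, fun x hx => ?_⟩
  · rw [Multiset.toFinset_card_of_nodup hnd, IsAlgClosed.card_roots_eq_natDegree, hdeg]
  · rw [Multiset.mem_toFinset, mem_roots hne] at hx
    simpa [sub_eq_zero] using hx

theorem exists_two_eval_eq [CharZero K] {p : K[X]} (hp : 2 ≤ p.natDegree) :
    ∃ a b, a ≠ b ∧ p.eval a = p.eval b := by
  obtain ⟨s, hs, c, hc⟩ := exists_card_fiber_eq_natDegree (p := p) (by omega)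
  obtain ⟨a, ha, b, hb, hab⟩ := Finset.one_lt_card.1 (show 1 < s.card by omega)
  exact ⟨a, b, hab, (hc a ha).trans (hc b hb).symm⟩

theorem exists_three_eval_eq [CharZero K] {p : K[X]} (hp : 3 ≤ p.natDegree) :
    ∃ a b c, a ≠ b ∧ b ≠ c ∧ a ≠ c ∧ p.eval a = p.eval b ∧ p.eval b = p.eval c := by
  obtain ⟨s, hs, d, hd⟩ := exists_card_fiber_eq_natDegree (p := p) (by omega)
  obtain ⟨a, b, c, ha, hb, hc, hab, hac, hbc⟩ :=
    Finset.two_lt_card_iff.1 (show 2 < s.card by omega)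
  exact ⟨a, b, c, hab, hbc, hac, (hd a ha).trans (hd b hb).symm, (hd b hb).trans (hd c hc).symm⟩

theorem eval_eq_of_injective [CharZero K] {p : K[X]} (h0 : p.eval 0 = 0)
    (hp : ∀ a b, p.eval a = p.eval b → a = b) :
    p.natDegree ≤ 1 ∧ p.coeff 1 ≠ 0 ∧ ∀ x, p.eval x = p.coeff 1 * x := by
  have hdeg : p.natDegree ≤ 1 := by
    by_contra! h
    obtain ⟨a, b, hab, he⟩ := exists_two_eval_eq h
    exact hab (hp a b he)
  refine ⟨hdeg, fun h => ?_, eval_eq_of_natDegree_le_one hdeg h0⟩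
  apply zero_ne_one (α := K)
  apply hp
  rw [eval_eq_of_natDegree_le_one hdeg h0, eval_eq_of_natDegree_le_one hdeg h0, h]
  simp

/-- A polynomial without nonzero roots is a monomial. -/
theorem coeff_eq_zero_or_of_forall_eval_ne_zero {p : K[X]} (hp : ∀ z, z ≠ 0 → p.eval z ≠ 0)
    {m n : ℕ} (hmn : m ≠ n) : p.coeff m = 0 ∨ p.coeff n = 0 := by
  have hroots : p.roots = Multiset.replicate (Multiset.card p.roots) 0 := by
    rw [Multiset.eq_replicate]
    refine ⟨rfl, fun z hz => ?_⟩
    by_contra h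
    exact hp z h (isRoot_of_mem_roots hz)
  have hprod := (IsAlgClosed.splits p).eq_prod_roots
  rw [hroots, Multiset.map_replicate, Multiset.prod_replicate, C_0, sub_zero] at hprod
  rw [hprod, coeff_C_mul_X_pow, coeff_C_mul_X_pow]
  by_cases h : m = Multiset.card p.roots
  · exact Or.inr (if_neg (by rw [← h]; exact hmn.symm))
  · exact Or.inl (if_neg h)


end Univariate

/-! ### Scaled hexagons. -/

/-- The coefficient of `z ^ n` in the alternating sum of `h` over the hexagon with `x`-coordinates
`x₁, x₂, x₃` and `y`-coordinates `z (f x₂ - f x₃), z (f x₂ - f x₁), 0`,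
where `p` is the coefficient of `y ^ n` in `h`; the sum of `f(x) y` over it is zero. -/
noncomputable def hexagonCoeff {K : Type*} [Field K] (f p : K[X]) (n : ℕ) (x₁ x₂ x₃ : K) : K :=
  (p.eval x₁ - p.eval x₂) * (f.eval x₂ - f.eval x₃) ^ n +
    (p.eval x₂ - p.eval x₃) * (f.eval x₂ - f.eval x₁) ^ n

section

variable {K : Type*} [Field K]

theorem eval_map_evalRingHom_eq_evalEval (h : K[X][Y]) (x y : K) :
    (h.map (evalRingHom x)).eval y = h.evalEval x y := by
  rw [eval_map, eval₂_evalRingHom]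

/-- If all hexagon coefficients vanish for some `n ≥ 2`, the polynomial is constant. -/
theorem eq_C_of_hexagonCoeff_eq_zero [CharZero K] {f p : K[X]} {n : ℕ} (hn : 2 ≤ n)
    (hf : ∀ b, ∃ x, f.eval b ≠ f.eval x)
    (H : ∀ x₁ x₂ x₃, hexagonCoeff f p n x₁ x₂ x₃ = 0) : p = C (p.coeff 0) := by
  apply eq_C_of_derivative_eq_zero
  apply Polynomial.funext
  intro b
  rw [eval_zero]
  obtain ⟨x₃, hx₃⟩ := hf b
  have hD : (f.eval b - f.eval x₃) ^ n ≠ 0 := pow_ne_zero _ (sub_ne_zero.2 hx₃)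
  -- Fix `x₂ = b` and let `x₁` vary. The right side vanishes to order `n ≥ 2` at `b`, so
  -- differentiating there gives `p'(b) = 0`.
  have key : (p - C (p.eval b)) * C ((f.eval b - f.eval x₃) ^ n) =
      C (p.eval x₃ - p.eval b) * (C (f.eval b) - f) ^ n := by
    apply Polynomial.funext
    intro x
    have := H x b x₃
    simp only [hexagonCoeff] at this
    simp only [eval_mul, eval_sub, eval_C, eval_pow]
    linear_combination this
  have := congrArg (fun q => (derivative q).eval b) key
  simp only [derivative_mul, derivative_sub, derivative_C, derivative_pow, eval_mul,
    eval_sub, eval_C, eval_pow, sub_self, sub_zero, zero_mul, mul_zero, add_zero, zero_add,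
    zero_pow (show n - 1 ≠ 0 by omega)] at this
  exact (mul_eq_zero.1 this).resolve_right hD

/-- The sum of `h` over the hexagon scaled by `z` is the polynomial `R(z)`. A nonzero root would
give a 6-cycle, so `R` is a monomial. -/
theorem hexagonCoeff_eq_zero_or [IsAlgClosed K] {f : K[X]} {h : K[X][Y]} (h0 : h.coeff 0 = 0)
    (H : NoShortCycle (fun x y => f.eval x * y) (fun x y => h.evalEval x y))
    {x₁ x₂ x₃ : K} (h₁₂ : f.eval x₁ ≠ f.eval x₂) (h₂₃ : f.eval x₂ ≠ f.eval x₃)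
    (h₁₃ : f.eval x₁ ≠ f.eval x₃) {m n : ℕ} (hmn : m ≠ n) :
    hexagonCoeff f (h.coeff m) m x₁ x₂ x₃ = 0 ∨ hexagonCoeff f (h.coeff n) n x₁ x₂ x₃ = 0 := by
  set R : K[X] :=
    (h.map (evalRingHom x₁) - h.map (evalRingHom x₂)).comp (C (f.eval x₂ - f.eval x₃) * X) +
    (h.map (evalRingHom x₂) - h.map (evalRingHom x₃)).comp (C (f.eval x₂ - f.eval x₁) * X) with hR
  have hcoeff : ∀ k, R.coeff k = hexagonCoeff f (h.coeff k) k x₁ x₂ x₃ := by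
    intro k
    simp only [hR, coeff_add, comp_C_mul_X_coeff, coeff_sub, coeff_map, coe_evalRingHom,
      hexagonCoeff]
  rw [← hcoeff, ← hcoeff]
  apply coeff_eq_zero_or_of_forall_eval_ne_zero _ hmn
  intro z hz hRz
  have hy0 : ∀ x, h.evalEval x 0 = 0 := by
    intro x
    rw [evalEval, C_0, ← coeff_zero_eq_eval_zero, h0, eval_zero]
  refine H.six x₁ x₂ x₃ ((f.eval x₂ - f.eval x₃) * z) ((f.eval x₂ - f.eval x₁) * z) 0
    (fun e => h₁₂ (e ▸ rfl)) (fun e => h₂₃ (e ▸ rfl)) (fun e => h₁₃ (e ▸ rfl)) ?_ ?_ ?_ ?_ ?_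
  · intro e
    have := mul_right_cancel₀ hz e
    exact h₁₃ (by linear_combination this)
  · exact mul_ne_zero (sub_ne_zero.2 h₁₂.symm) hz
  · exact mul_ne_zero (sub_ne_zero.2 h₂₃) hz
  · ring
  · simp only [hy0]
    simp only [hR, eval_add, eval_comp, eval_sub, eval_mul, eval_C, eval_X,
      eval_map_evalRingHom_eq_evalEval] at hRz
    linear_combination hRz

end

/-! ### Degree bounds, and the case of quadratic `f`. -/

section

variable {K : Type*} [Field K] [IsAlgClosed K] [CharZero K] {f : K[X]} {h : K[X][Y]}

/-- When `f(a) = f(b)` the first alternating sum of a quadrangle on `a, b` vanishes for free, so a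
collision of `y ↦ h(a, y) - h(b, y)` is a 4-cycle. An injective polynomial map is linear with
nonzero slope. -/
theorem NoShortCycle.evalEval_sub_of_eval_eq {g : K[X]} (h0 : h.coeff 0 = 0)
    (H : NoShortCycle (fun x y => f.eval x * g.eval y) (fun x y => h.evalEval x y)) {a b : K}
    (hab : a ≠ b) (hf : f.eval a = f.eval b) :
    (h.coeff 1).eval a ≠ (h.coeff 1).eval b ∧
    (∀ n, 2 ≤ n → (h.coeff n).eval a = (h.coeff n).eval b) ∧
    ∀ y, h.evalEval a y - h.evalEval b y = ((h.coeff 1).eval a - (h.coeff 1).eval b) * y := by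
  have hev : ∀ y, (h.map (evalRingHom a) - h.map (evalRingHom b)).eval y =
      h.evalEval a y - h.evalEval b y := by
    intro y
    simp only [eval_sub, eval_map_evalRingHom_eq_evalEval]
  have := eval_eq_of_injective (p := h.map (evalRingHom a) - h.map (evalRingHom b))
    (by rw [← coeff_zero_eq_eval_zero]; simp [h0]) (by
      intro u v huv
      by_contra hne
      rw [hev, hev] at huv
      exact H.four a b u v hab hne (by simp only [hf]; ring) (by linear_combination huv))
  obtain ⟨h₁, h₂, h₃⟩ := this
  simp only [hev, coeff_sub, coeff_map, coe_evalRingHom] at h₂ h₃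
  refine ⟨sub_ne_zero.1 h₂, fun n hn => ?_, h₃⟩
  have := coeff_eq_zero_of_natDegree_lt (lt_of_le_of_lt h₁ hn)
  simpa [sub_eq_zero] using this

theorem NoShortCycle.natDegree_le_two (h0 : h.coeff 0 = 0)
    (H : NoShortCycle (fun x y => f.eval x * y) (fun x y => h.evalEval x y)) :
    f.natDegree ≤ 2 := by
  by_contra! hlt
  obtain ⟨a, b, c, hab, hbc, hac, e₁, e₂⟩ := exists_three_eval_eq hlt
  have H' : NoShortCycle (fun x y => f.eval x * (X : K[X]).eval y)
    (fun x y => h.evalEval x y) := by simpa using H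
  obtain ⟨u₁, -, v₁⟩ := H'.evalEval_sub_of_eval_eq h0 hab e₁
  obtain ⟨u₂, -, v₂⟩ := H'.evalEval_sub_of_eval_eq h0 hbc e₂
  obtain ⟨u₃, -, v₃⟩ := H'.evalEval_sub_of_eval_eq h0 hac (e₁.trans e₂)
  set p := h.coeff 1
  -- On a fibre of `f` the first sum is zero, and the second is `(p(a) - p(b)) y₁ + (p(b) - p(c)) y₂
  -- - (p(a) - p(c)) y₃`, which these values annihilate.
  refine H.six a b c (p.eval b - p.eval c) (p.eval b - p.eval a) 0 hab hbc hac
    (fun e => u₃ (by linear_combination e)) (sub_ne_zero.2 u₁.symm) (sub_ne_zero.2 u₂) ?_ ?_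
  · simp only [e₁, e₂]
    ring
  · linear_combination v₁ (p.eval b - p.eval c) + v₂ (p.eval b - p.eval a) - v₃ 0

theorem NoShortCycle.natDegree_le_one_or {g : K[X]} (h0 : h.coeff 0 = 0)
    (h0' : ∀ y, h.evalEval 0 y = 0)
    (H : NoShortCycle (fun x y => f.eval x * g.eval y) (fun x y => h.evalEval x y)) :
    f.natDegree ≤ 1 ∨ g.natDegree ≤ 1 := by
  classical
  by_contra! hlt
  obtain ⟨x₁, x₂, hx, hf⟩ := exists_two_eval_eq hlt.1
  obtain ⟨y₂, y₃, hy, hg⟩ := exists_two_eval_eq hlt.2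
  obtain ⟨hu, -, hv⟩ := H.evalEval_sub_of_eval_eq h0 hx hf
  set l := (h.coeff 1).eval x₁ - (h.coeff 1).eval x₂ with hl
  have hl0 : l ≠ 0 := sub_ne_zero.2 hu
  obtain ⟨-, hm0, hm⟩ := eval_eq_of_injective (p := h.eval (C y₂) - h.eval (C y₃))
    (by
      have e₁ := h0' y₂
      have e₂ := h0' y₃
      rw [evalEval] at e₁ e₂
      rw [eval_sub, e₁, e₂, sub_zero]) (by
      intro u v huv
      by_contra hne
      rw [eval_sub, eval_sub] at huv
      exact H.four u v y₂ y₃ hne hy (by simp only [hg]; ring) (by linear_combination huv))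
  set m := (h.eval (C y₂) - h.eval (C y₃)).coeff 1
  -- With `f(x₁) = f(x₂)` and `g(y₂) = g(y₃)` the first sum vanishes, and the second is `l (y₁ - y₃)
  -- + m (x₂ - x₃)`. Solving it for `y₁`, the last excluded value of `x₃` is the one giving `y₁ =
  -- y₂`.
  obtain ⟨x₃, hx₃⟩ := Infinite.exists_notMem_finset
    ({x₁, x₂, x₂ - l * (y₃ - y₂) / m} : Finset K)
  simp only [Finset.mem_insert, Finset.mem_singleton, not_or] at hx₃
  obtain ⟨hx₃₁, hx₃₂, hx₃₃⟩ := hx₃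
  have hm' : ∀ x, h.evalEval x y₂ - h.evalEval x y₃ = m * x := by
    intro x
    rw [← hm, eval_sub]
  refine H.six x₁ x₂ x₃ (y₃ - m * (x₂ - x₃) / l) y₂ y₃ hx (Ne.symm hx₃₂) (Ne.symm hx₃₁) ?_ hy ?_
    ?_ ?_
  · intro e
    apply hx₃₃
    field_simp at e ⊢
    linear_combination e
  · intro e
    have : m * (x₂ - x₃) / l = 0 := by linear_combination -e
    rw [div_eq_zero_iff, mul_eq_zero, sub_eq_zero] at this
    rcases this with (h | h) | h
    · exact hm0 h
    · exact hx₃₂ h.symm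
    · exact hl0 h
  · simp only [hf, hg]
    ring
  · have e₁ := hv (y₃ - m * (x₂ - x₃) / l)
    have e₂ := hv y₃
    have e₃ : l * (m * (x₂ - x₃) / l) = m * (x₂ - x₃) := by field_simp
    linear_combination e₁ - e₂ + hm' x₂ - hm' x₃ - e₃

/-- If `h = p(x) y`, then `p` has degree at most two. -/
theorem NoShortCycle.natDegree_coeff_one_le_two {p : K[X]}
    (H : NoShortCycle (fun x y => f.eval x * y) (fun x y => p.eval x * y)) :
    p.natDegree ≤ 2 := by
  by_contra! hlt
  obtain ⟨a, b, c, hab, hbc, hac, e₁, e₂⟩ := exists_three_eval_eq hlt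
  have hne : ∀ x x', x ≠ x' → p.eval x = p.eval x' → f.eval x ≠ f.eval x' := by
    intro x x' hx hp hf
    exact H.four x x' 0 1 hx zero_ne_one (by simp [hf]) (by simp [hp])
  have u₁ := hne a b hab e₁
  have u₂ := hne b c hbc e₂
  have u₃ := hne a c hac (e₁.trans e₂)
  refine H.six a b c (f.eval b - f.eval c) (f.eval b - f.eval a) 0 hab hbc hac
    (fun e => u₃ (by linear_combination e)) (sub_ne_zero.2 u₁.symm) (sub_ne_zero.2 u₂) ?_ ?_
  · ring
  · simp only [e₁, e₂]
    ring

/-- A girth eight graph defined by `x (x - a) y` and `h` has `h = p(x) y`. -/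
theorem NoShortCycle.coeff_eq_zero_of_rho {a : K} (h0 : h.coeff 0 = 0)
    (h0' : ∀ n, (h.coeff n).eval 0 = 0)
    (H : NoShortCycle (fun x y => (rho a).eval x * y) (fun x y => h.evalEval x y))
    {n : ℕ} (hn : 2 ≤ n) : h.coeff n = 0 := by
  have H' : NoShortCycle (fun x y => (rho a).eval x * (X : K[X]).eval y)
    (fun x y => h.evalEval x y) := by simpa using H
  have hrho : ∀ x, (rho a).eval (a - x) = (rho a).eval x := by
    intro x
    simp [rho]
    ring
  have hflip : ∀ x, (h.coeff n).eval (a - x) = (h.coeff n).eval x := by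
    intro x
    by_cases hx : a - x = x
    · rw [hx]
    · exact (H'.evalEval_sub_of_eval_eq h0 hx (hrho x)).2.1 n hn
  have hfib : ∀ x y, (rho a).eval x = (rho a).eval y →
      (h.coeff n).eval x = (h.coeff n).eval y := by
    intro x y hxy
    by_cases hx : x = y
    · rw [hx]
    · exact (H'.evalEval_sub_of_eval_eq h0 hx hxy).2.1 n hn
  -- If this were nonzero, the coefficient for exponent 1 would vanish at the triple, and also after
  -- reflecting one point, since reflection preserves `ρ_a` and the coefficient for `n`. But
  -- `h.coeff 1` separates a point from its distinct reflection. At most one of `x₁`, `x₃` is fixed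
  -- by reflection, so one of them can be moved.
  have hzero : ∀ x₁ x₂ x₃, hexagonCoeff (rho a) (h.coeff n) n x₁ x₂ x₃ = 0 := by
    intro x₁ x₂ x₃
    have hn0 : n ≠ 0 := by omega
    by_cases h₁₂ : (rho a).eval x₁ = (rho a).eval x₂
    · simp [hexagonCoeff, hfib _ _ h₁₂, h₁₂, hn0]
    by_cases h₂₃ : (rho a).eval x₂ = (rho a).eval x₃
    · simp [hexagonCoeff, hfib _ _ h₂₃, h₂₃, hn0]
    by_cases h₁₃ : (rho a).eval x₁ = (rho a).eval x₃
    · simp only [hexagonCoeff, hfib _ _ h₁₃, h₁₃]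
      ring
    by_contra hne
    have k₁ := (hexagonCoeff_eq_zero_or h0 H h₁₂ h₂₃ h₁₃ (show 1 ≠ n by omega)).resolve_right hne
    by_cases hx₁ : a - x₁ = x₁
    · have hx₃ : a - x₃ ≠ x₃ := by
        intro hx₃
        apply h₁₃
        have : (2 : K) * (x₁ - x₃) = 0 := by linear_combination hx₃ - hx₁
        have := (mul_eq_zero.1 this).resolve_left two_ne_zero
        rw [sub_eq_zero.1 this]
      have k₂ := (hexagonCoeff_eq_zero_or h0 H (x₁ := x₁) (x₂ := x₂) (x₃ := a - x₃) h₁₂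
        (by rwa [hrho]) (by rwa [hrho]) (show 1 ≠ n by omega)).resolve_right (by
          simpa only [hexagonCoeff, hrho, hflip] using hne)
      simp only [hexagonCoeff, hrho, pow_one] at k₁ k₂
      have : ((h.coeff 1).eval (a - x₃) - (h.coeff 1).eval x₃) *
        ((rho a).eval x₂ - (rho a).eval x₁) = 0 := by linear_combination k₁ - k₂
      rcases mul_eq_zero.1 this with e | e
      · exact (H'.evalEval_sub_of_eval_eq h0 hx₃ (hrho x₃)).1 (sub_eq_zero.1 e)
      · exact h₁₂ (sub_eq_zero.1 e).symm
    · have k₂ := (hexagonCoeff_eq_zero_or h0 H (x₁ := a - x₁) (x₂ := x₂) (x₃ := x₃)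
        (by rwa [hrho]) h₂₃ (by rwa [hrho]) (show 1 ≠ n by omega)).resolve_right (by
          simpa only [hexagonCoeff, hrho, hflip] using hne)
      simp only [hexagonCoeff, hrho, pow_one] at k₁ k₂
      have : ((h.coeff 1).eval (a - x₁) - (h.coeff 1).eval x₁) *
        ((rho a).eval x₂ - (rho a).eval x₃) = 0 := by linear_combination k₂ - k₁
      rcases mul_eq_zero.1 this with e | e
      · exact (H'.evalEval_sub_of_eval_eq h0 hx₁ (hrho x₁)).1 (sub_eq_zero.1 e)
      · exact h₂₃ (sub_eq_zero.1 e)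
  have hC := eq_C_of_hexagonCoeff_eq_zero (f := rho a) hn (by
    intro b
    by_contra! hconst
    have e₁ := hconst 1
    have e₂ := hconst (-1)
    -- Nonconstancy comes from `ρ_a(1) + ρ_a(-1) - 2 ρ_a(0) = 2`.
    have e₃ := hconst 0
    simp only [rho, eval_mul, eval_sub, eval_X, eval_C] at e₁ e₂ e₃
    have : (2 : K) = 0 := by linear_combination 2 * e₃ - e₁ - e₂
    exact two_ne_zero this) hzero
  have := h0' n
  rw [hC, eval_C] at this
  rw [hC, this, C_0]

end

/-! ### Linear `f` and `g`: separating the degrees in `y`. -/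

section

variable {K : Type*} [Field K]

/-- The hexagon coefficients for `f = X` as a polynomial in the three `x`-coordinates. -/
noncomputable def hexagonPolynomial (p : K[X]) (n : ℕ) : MvPolynomial (Fin 3) K :=
  (aeval (MvPolynomial.X 0) p - aeval (MvPolynomial.X 1) p) *
      (MvPolynomial.X 1 - MvPolynomial.X 2) ^ n +
    (aeval (MvPolynomial.X 1) p - aeval (MvPolynomial.X 2) p) *
      (MvPolynomial.X 1 - MvPolynomial.X 0) ^ n

theorem eval_hexagonPolynomial (p : K[X]) (n : ℕ) (v : Fin 3 → K) :
    MvPolynomial.eval v (hexagonPolynomial p n) = hexagonCoeff X p n (v 0) (v 1) (v 2) := by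
  have h : ∀ i, MvPolynomial.eval v (aeval (MvPolynomial.X i) p) = p.eval (v i) := by
    intro i
    rw [← MvPolynomial.coe_aeval_eq_eval, RingHom.coe_coe, ← aeval_algHom_apply,
      MvPolynomial.aeval_X, coe_aeval_eq_eval]
  simp only [hexagonPolynomial, hexagonCoeff, map_add, map_mul, map_sub, map_pow, h,
    MvPolynomial.eval_X, eval_X]

/-- The alternative is known only triple by triple. Multiplied by the Vandermonde factor, the
product of the two polynomials vanishes everywhere, so one of them is zero because the polynomial
ring is a domain. -/
theorem forall_hexagonCoeff_eq_zero_or [IsAlgClosed K] {h : K[X][Y]} (h0 : h.coeff 0 = 0)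
    (H : NoShortCycle (fun x y : K => x * y) (fun x y => h.evalEval x y)) {m n : ℕ} (hmn : m ≠ n) :
    (∀ x₁ x₂ x₃, hexagonCoeff X (h.coeff m) m x₁ x₂ x₃ = 0) ∨
      ∀ x₁ x₂ x₃, hexagonCoeff X (h.coeff n) n x₁ x₂ x₃ = 0 := by
  have H' : NoShortCycle (fun x y => (X : K[X]).eval x * y) (fun x y => h.evalEval x y) := by
    simpa using H
  have hX : ∀ i j : Fin 3, i ≠ j →
      (MvPolynomial.X i - MvPolynomial.X j : MvPolynomial (Fin 3) K) ≠ 0 :=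
    fun i j hij => sub_ne_zero.2 fun e => hij (MvPolynomial.X_injective e)
  have key : hexagonPolynomial (h.coeff m) m * hexagonPolynomial (h.coeff n) n *
      ((MvPolynomial.X 0 - MvPolynomial.X 1) * (MvPolynomial.X 1 - MvPolynomial.X 2) *
        (MvPolynomial.X 0 - MvPolynomial.X 2)) = 0 := by
    apply MvPolynomial.funext
    intro v
    simp only [map_mul, map_sub, MvPolynomial.eval_X, eval_hexagonPolynomial, map_zero,
      mul_eq_zero, sub_eq_zero]
    by_contra! hne
    rcases hexagonCoeff_eq_zero_or h0 H' (x₁ := v 0) (x₂ := v 1) (x₃ := v 2)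
      (by simpa using hne.2.1.1) (by simpa using hne.2.1.2) (by simpa using hne.2.2) hmn with e | e
    · exact hne.1.1 e
    · exact hne.1.2 e
  have hvanish : ∀ k, hexagonPolynomial (h.coeff k) k = 0 →
      ∀ x₁ x₂ x₃, hexagonCoeff X (h.coeff k) k x₁ x₂ x₃ = 0 := by
    intro k hk x₁ x₂ x₃
    have := eval_hexagonPolynomial (h.coeff k) k ![x₁, x₂, x₃]
    rw [hk, map_zero] at this
    exact this.symm
  have hV : ((MvPolynomial.X 0 - MvPolynomial.X 1) * (MvPolynomial.X 1 - MvPolynomial.X 2) *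
        (MvPolynomial.X 0 - MvPolynomial.X 2) : MvPolynomial (Fin 3) K) ≠ 0 :=
    mul_ne_zero (mul_ne_zero (hX 0 1 (by decide)) (hX 1 2 (by decide))) (hX 0 2 (by decide))
  rcases mul_eq_zero.1 ((mul_eq_zero.1 key).resolve_right hV) with e | e
  · exact Or.inl (hvanish m e)
  · exact Or.inr (hvanish n e)

theorem coeff_zero_eq_zero_of_mixed {h : K[X][Y]}
    (hmixed : ∀ i j : ℕ, biCoeff h i j ≠ 0 → 1 ≤ i ∧ 1 ≤ j) : h.coeff 0 = 0 := by
  ext i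
  by_contra hne
  exact absurd (hmixed i 0 hne).2 (by norm_num)

/-- For the graph defined by `x y` and `h`, apart from `x y` all terms of `h` have the same
degree in `y`. -/
theorem exists_forall_biCoeff_ne_zero [IsAlgClosed K] [CharZero K] {h : K[X][Y]}
    (hmixed : ∀ i j : ℕ, biCoeff h i j ≠ 0 → 1 ≤ i ∧ 1 ≤ j)
    (H : NoShortCycle (fun x y : K => x * y) (fun x y => h.evalEval x y)) :
    ∃ N, ∀ i j, biCoeff h i j ≠ 0 → j ≠ N → i = 1 ∧ j = 1 := by
  have h0 := coeff_zero_eq_zero_of_mixed hmixed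
  have hN : ∃ N, ∀ n, n ≠ N → ∀ x₁ x₂ x₃, hexagonCoeff X (h.coeff n) n x₁ x₂ x₃ = 0 := by
    by_cases hex : ∃ N, ¬ ∀ x₁ x₂ x₃, hexagonCoeff X (h.coeff N) N x₁ x₂ x₃ = 0
    · obtain ⟨N, hN⟩ := hex
      exact ⟨N, fun n hn => (forall_hexagonCoeff_eq_zero_or h0 H hn).resolve_right hN⟩
    -- No exceptional exponent occurs, so any `N` would serve.
    · exact ⟨0, fun n _ => not_not.1 (not_exists.1 hex n)⟩
  obtain ⟨N, hN⟩ := hN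
  refine ⟨N, fun i j hij hj => ?_⟩
  obtain ⟨hi1, hj1⟩ := hmixed i j hij
  have hQ := hN j hj
  rcases hj1.eq_or_lt with rfl | hj2
  · refine ⟨?_, rfl⟩
    have hlin : h.coeff 1 = C ((h.coeff 1).eval 1 - (h.coeff 1).eval 0) * X +
        C ((h.coeff 1).eval 0) := by
      apply Polynomial.funext
      intro x
      have := hQ x 0 1
      simp only [hexagonCoeff, eval_X, pow_one] at this
      simp only [eval_add, eval_mul, eval_C, eval_X]
      linear_combination -this
    by_contra hi
    apply hij
    rw [biCoeff, hlin, coeff_add, coeff_C_mul, coeff_X_of_ne_one hi, coeff_C_of_ne_zero (by omega)]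
    simp
  · exfalso
    apply hij
    rw [biCoeff, eq_C_of_hexagonCoeff_eq_zero hj2 (fun b => ⟨b + 1, by simp⟩) hQ,
      coeff_C_of_ne_zero (by omega)]

/-! ### Exchanging the variables; coefficients and normal forms. -/

theorem biCoeff_swap (h : K[X][Y]) (i j : ℕ) : biCoeff (Bivariate.swap h) i j = biCoeff h j i := by
  induction h using Polynomial.induction_on' with
  | add p q hp hq => simp_all [biCoeff]
  | monomial n f =>
    induction f using Polynomial.induction_on' with
    | add p q hp hq => simp_all [biCoeff]
    | monomial m r =>
      rw [Bivariate.swap_monomial_monomial]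
      simp only [biCoeff, coeff_monomial]
      split_ifs <;> simp_all [coeff_monomial]

theorem evalEval_swap (h : K[X][Y]) (x y : K) :
    (Bivariate.swap h).evalEval x y = h.evalEval y x := by
  rw [← coe_aevalAeval_eq_evalEval, ← coe_aevalAeval_eq_evalEval]
  exact Bivariate.aevalAeval_swap x y h

end

section

variable {K : Type*} [Field K]

@[simp] theorem swap_biConst (c : K) : Bivariate.swap (biConst c) = biConst c :=
  Bivariate.swap_C_C c

@[simp] theorem swap_inX (f : K[X]) : Bivariate.swap (inX f) = inY f :=
  Bivariate.swap_C f

@[simp] theorem swap_inY (f : K[X]) : Bivariate.swap (inY f) = inX f :=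
  Bivariate.swap_map_C f

@[simp] theorem evalEval_biConst (c x y : K) : (biConst c).evalEval x y = c := by
  simp [biConst]

@[simp] theorem evalEval_inX (f : K[X]) (x y : K) : (inX f).evalEval x y = f.eval x :=
  evalEval_C ..

@[simp] theorem evalEval_inY (f : K[X]) (x y : K) : (inY f).evalEval x y = f.eval y :=
  evalEval_map_C ..

@[simp] theorem eval_rho (a x : K) : (rho a).eval x = x * (x - a) := by
  simp [rho]

theorem eval_zero_coeff_of_mixed {h : K[X][Y]}
    (hmixed : ∀ i j : ℕ, biCoeff h i j ≠ 0 → 1 ≤ i ∧ 1 ≤ j) (n : ℕ) :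
    (h.coeff n).eval 0 = 0 := by
  rw [← coeff_zero_eq_eval_zero]
  by_contra hne
  exact absurd (hmixed 0 n hne).1 (by norm_num)

theorem mixed_swap {h : K[X][Y]} (hmixed : ∀ i j : ℕ, biCoeff h i j ≠ 0 → 1 ≤ i ∧ 1 ≤ j) :
    ∀ i j : ℕ, biCoeff (Bivariate.swap h) i j ≠ 0 → 1 ≤ i ∧ 1 ≤ j := by
  intro i j hij
  rw [biCoeff_swap] at hij
  exact (hmixed j i hij).symm

theorem evalEval_zero_left_of_mixed {h : K[X][Y]}
    (hmixed : ∀ i j : ℕ, biCoeff h i j ≠ 0 → 1 ≤ i ∧ 1 ≤ j) (y : K) : h.evalEval 0 y = 0 := by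
  rw [← eval_map_evalRingHom_eq_evalEval]
  have : h.map (evalRingHom 0) = 0 := by
    ext n
    rw [coeff_map, coe_evalRingHom, eval_zero_coeff_of_mixed hmixed, coeff_zero]
  rw [this, eval_zero]

theorem eq_C_mul_X_of_coeff_eq_zero {h : K[X][Y]} (hh : ∀ n, n ≠ 1 → h.coeff n = 0) :
    h = C (h.coeff 1) * X := by
  ext1 n
  by_cases hn : n = 1
  · subst hn
    simp
  · rw [hh n hn, coeff_C_mul, coeff_X_of_ne_one hn, mul_zero]

theorem eq_quadratic_of_eval_zero {p : K[X]} (hp : p.natDegree ≤ 2) (h0 : p.eval 0 = 0) :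
    p = C (p.coeff 1) * X + C (p.coeff 2) * X ^ 2 := by
  rw [← coeff_zero_eq_eval_zero] at h0
  conv_lhs => rw [eq_quadratic_of_degree_le_two (natDegree_le_iff_degree_le.1 hp), h0]
  rw [C_0, add_zero, add_comm]

theorem eq_X_of_monic {f : K[X]} (hf : f.Monic) (h0 : f.eval 0 = 0) (hd : f.natDegree ≤ 1) :
    f = X := by
  have h1 : f.natDegree ≠ 0 := by
    intro h
    rw [hf.natDegree_eq_zero.1 h, eval_one] at h0
    exact one_ne_zero h0
  have h2 : f.coeff 1 = 1 := by
    rw [← hf.coeff_natDegree]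
    congr 1
    omega
  rw [← coeff_zero_eq_eval_zero] at h0
  rw [eq_X_add_C_of_natDegree_le_one hd, h2, h0]
  simp

theorem eq_rho_of_monic {f : K[X]} (hf : f.Monic) (h0 : f.eval 0 = 0) (hd : f.natDegree = 2) :
    f = rho (-f.coeff 1) := by
  have h2 : f.coeff 2 = 1 := by
    rw [← hd]
    exact hf.coeff_natDegree
  conv_lhs => rw [eq_quadratic_of_eval_zero hd.le h0, h2]
  rw [rho, C_neg, C_1]
  ring

end

/-! ### The possible forms of `h`. -/

section

variable {K : Type*} [Field K] [IsAlgClosed K] [CharZero K] {h : K[X][Y]}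

theorem NoShortCycle.eq_of_rho {a : K}
    (hmixed : ∀ i j : ℕ, biCoeff h i j ≠ 0 → 1 ≤ i ∧ 1 ≤ j)
    (H : NoShortCycle (fun x y => (rho a).eval x * y) (fun x y => h.evalEval x y)) :
    ∃ ζ, ζ ≠ 0 ∧
      h = biConst ζ * inX X * inY X + biConst (biCoeff h 2 1) * inX (rho a) * inY X := by
  have h0 := coeff_zero_eq_zero_of_mixed hmixed
  have h0' := eval_zero_coeff_of_mixed hmixed
  have hC : h = C (h.coeff 1) * X := by
    apply eq_C_mul_X_of_coeff_eq_zero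
    intro n hn
    rcases Nat.eq_zero_or_pos n with rfl | hpos
    · exact h0
    · exact H.coeff_eq_zero_of_rho h0 h0' (by omega)
  have hd : (h.coeff 1).natDegree ≤ 2 := by
    apply NoShortCycle.natDegree_coeff_one_le_two (f := rho a)
    have hev : ∀ x y, h.evalEval x y = (h.coeff 1).eval x * y := by
      intro x y
      conv_lhs => rw [hC]
      rw [evalEval_mul, evalEval_C, evalEval_X]
    simpa only [hev] using H
  have hquad := eq_quadratic_of_eval_zero hd (h0' 1)
  -- This is the coefficient of `x` once `p` is rewritten through `ρ_a` and `x`. It is nonzero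
  -- because `p` must separate `a/2 + 1` and `a/2 - 1`, where `ρ_a` agrees; the difference of values
  -- is `2ζ`.
  refine ⟨(h.coeff 1).coeff 1 + a * (h.coeff 1).coeff 2, fun hζ => ?_, ?_⟩
  · have H' : NoShortCycle (fun x y => (rho a).eval x * (X : K[X]).eval y)
      (fun x y => h.evalEval x y) := by simpa using H
    apply (H'.evalEval_sub_of_eval_eq h0 (a := a / 2 + 1) (b := a / 2 - 1) (by
      intro e
      have : (2 : K) = 0 := by linear_combination e
      exact two_ne_zero this) (by
      rw [eval_rho, eval_rho]
      ring)).1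
    rw [hquad]
    simp only [eval_add, eval_mul, eval_C, eval_X, eval_pow]
    linear_combination 2 * hζ
  · conv_lhs => rw [hC, hquad]
    simp only [biConst, inX, inY, rho, biCoeff, map_X, C_add, C_mul, C_sub, C_pow]
    ring

theorem NoShortCycle.eq_biConst_mul_inX_rho (hC : h = C (h.coeff 1) * X)
    (h0' : (h.coeff 1).eval 0 = 0)
    (H : NoShortCycle (fun x y : K => x * y) (fun x y => h.evalEval x y)) :
    ∃ a ζ, ζ ≠ 0 ∧ h = biConst ζ * inX (rho a) * inY X := by
  have hev : ∀ x y, h.evalEval x y = (h.coeff 1).eval x * y := by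
    intro x y
    conv_lhs => rw [hC]
    rw [evalEval_mul, evalEval_C, evalEval_X]
  have hd : (h.coeff 1).natDegree ≤ 2 := by
    apply NoShortCycle.natDegree_coeff_one_le_two (f := X)
    simpa only [hev, eval_X] using H
  have hquad := eq_quadratic_of_eval_zero hd h0'
  set b := (h.coeff 1).coeff 1
  set ζ := (h.coeff 1).coeff 2
  have hζ : ζ ≠ 0 := by
    intro hζ
    rw [hζ, C_0, zero_mul, add_zero] at hquad
    -- Without a quadratic term `h` is a multiple of `x y`, and any hexagon for `x y` is a 6-cycle.
    refine H.six 0 1 (-1) 2 1 0 (by simp) ?_ (by simp) (by simp) (by simp) (by simp) (by ring) ?_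
    · intro e
      have : (2 : K) = 0 := by linear_combination e
      exact two_ne_zero this
    · simp only [hev, hquad, eval_mul, eval_C, eval_X]
      ring
  refine ⟨-b / ζ, ζ, hζ, ?_⟩
  have hb : b = ζ * (b / ζ) := by field_simp
  conv_lhs => rw [hC, hquad, hb]
  simp only [biConst, inX, inY, rho, map_X, C_add, C_mul, C_sub, C_pow, neg_div, C_neg]
  ring

/-- There are hexagons on which both `x y` and `x ^ m * y ^ n` have alternating sum zero, if
`2 ≤ m` and `2 ≤ n`. -/
theorem exists_hexagon_monomial {m n : ℕ} (hm : 2 ≤ m) (hn : 2 ≤ n) :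
    ∃ x₁ x₂ x₃ y₁ y₂ y₃ : K, x₁ ≠ x₂ ∧ x₂ ≠ x₃ ∧ x₁ ≠ x₃ ∧ y₁ ≠ y₂ ∧ y₂ ≠ y₃ ∧ y₁ ≠ y₃ ∧
      x₁ * y₁ - x₂ * y₁ + x₂ * y₂ - x₃ * y₂ + x₃ * y₃ - x₁ * y₃ = 0 ∧
      x₁ ^ m * y₁ ^ n - x₂ ^ m * y₁ ^ n + x₂ ^ m * y₂ ^ n - x₃ ^ m * y₂ ^ n +
        x₃ ^ m * y₃ ^ n - x₁ ^ m * y₃ ^ n = 0 := by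
  by_cases hm3 : 3 ≤ m
  · obtain ⟨a, b, c, hab, hbc, hac, e₁, e₂⟩ := exists_three_eval_eq (p := (X ^ m : K[X]))
      (by simpa using hm3)
    simp only [eval_pow, eval_X] at e₁ e₂
    refine ⟨a, b, c, b - c, b - a, 0, hab, hbc, hac, fun e => hac (by linear_combination e),
      sub_ne_zero.2 hab.symm, sub_ne_zero.2 hbc, by ring, ?_⟩
    rw [e₁, e₂]
    ring
  by_cases hn3 : 3 ≤ n
  · obtain ⟨a, b, c, hab, hbc, hac, e₁, e₂⟩ := exists_three_eval_eq (p := (X ^ n : K[X]))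
      (by simpa using hn3)
    simp only [eval_pow, eval_X] at e₁ e₂
    refine ⟨a - b, a - c, 0, a, b, c, fun e => hbc (by linear_combination -e), sub_ne_zero.2 hac,
      sub_ne_zero.2 hab, hab, hbc, hac, by ring, ?_⟩
    rw [e₁, e₂]
    ring
  obtain rfl : m = 2 := by omega
  obtain rfl : n = 2 := by omega
  have h2 : (2 : K) ≠ 0 := two_ne_zero
  refine ⟨1, 0, -1, 1, -1, 0, one_ne_zero, by simp, ?_, ?_, by simp, one_ne_zero, by ring,
    by ring⟩
  · intro e
    exact h2 (by linear_combination e)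
  · intro e
    exact h2 (by linear_combination e)

theorem NoShortCycle.eq_of_X
    (hmixed : ∀ i j : ℕ, biCoeff h i j ≠ 0 → 1 ≤ i ∧ 1 ≤ j)
    (H : NoShortCycle (fun x y : K => x * y) (fun x y => h.evalEval x y)) :
    ∃ a ζ, ζ ≠ 0 ∧ (h = biConst ζ * inX (rho a) * inY X ∨
      h = biConst ζ * inX X * inY (rho a)) := by
  have Hs : NoShortCycle (fun x y : K => x * y)
      (fun x y => (Bivariate.swap h).evalEval x y) := by
    simpa only [evalEval_swap, mul_comm] using H.swap
  have hs := mixed_swap hmixed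
  obtain ⟨N, hN⟩ := exists_forall_biCoeff_ne_zero hmixed H
  obtain ⟨M, hM⟩ := exists_forall_biCoeff_ne_zero hs Hs
  by_cases hN1 : N = 1
  · have hC := eq_C_mul_X_of_coeff_eq_zero (h := h) (fun n hn => by
      ext i
      by_contra hne
      exact hn (hN i n hne (by rwa [hN1])).2)
    obtain ⟨a, ζ, hζ, e⟩ := H.eq_biConst_mul_inX_rho hC (eval_zero_coeff_of_mixed hmixed 1)
    exact ⟨a, ζ, hζ, Or.inl e⟩
  by_cases hM1 : M = 1
  · have hC := eq_C_mul_X_of_coeff_eq_zero (h := Bivariate.swap h) (fun n hn => by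
      ext i
      by_contra hne
      exact hn (hM i n hne (by rwa [hM1])).2)
    obtain ⟨a, ζ, hζ, e⟩ := Hs.eq_biConst_mul_inX_rho hC (eval_zero_coeff_of_mixed hs 1)
    refine ⟨a, ζ, hζ, Or.inr ?_⟩
    rw [← Bivariate.swap_swap_apply h, e]
    simp only [map_mul, swap_biConst, swap_inX, swap_inY]
    ring
  exfalso
  -- With `N, M ≠ 1`, a term other than `x y` must have `y`-degree `N` and `x`-degree `M`.
  simp only [biCoeff_swap] at hM
  have hform : h = monomial 1 (monomial 1 (biCoeff h 1 1)) +
      monomial N (monomial M (biCoeff h M N)) := by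
    ext j i
    simp only [coeff_add, coeff_monomial]
    by_cases hj : j = N
    · subst hj
      rw [if_neg (Ne.symm hN1), if_pos rfl, coeff_zero, zero_add, coeff_monomial]
      split_ifs with hi
      · rw [hi, biCoeff]
      · by_contra hne
        exact hN1 (hM j i hne (Ne.symm hi)).1
    · rw [if_neg (Ne.symm hj), coeff_zero, add_zero]
      by_contra hne
      by_cases hij : biCoeff h i j = 0
      · apply hne
        rw [show (h.coeff j).coeff i = 0 from hij]
        split_ifs with hj1
        · subst hj1
          rw [coeff_monomial]
          split_ifs with hi1
          · rw [hi1, ← hij, hi1]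
          · rfl
        · rw [coeff_zero]
      · obtain ⟨rfl, rfl⟩ := hN i j hij hj
        apply hne
        simp [biCoeff]
  have hev : ∀ x y, h.evalEval x y = biCoeff h 1 1 * x * y + biCoeff h M N * x ^ M * y ^ N := by
    intro x y
    conv_lhs => rw [hform]
    simp [evalEval, eval_monomial, mul_comm, mul_left_comm]
  have hhex : ∃ x₁ x₂ x₃ y₁ y₂ y₃ : K,
      x₁ ≠ x₂ ∧ x₂ ≠ x₃ ∧ x₁ ≠ x₃ ∧ y₁ ≠ y₂ ∧ y₂ ≠ y₃ ∧ y₁ ≠ y₃ ∧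
      x₁ * y₁ - x₂ * y₁ + x₂ * y₂ - x₃ * y₂ + x₃ * y₃ - x₁ * y₃ = 0 ∧
      biCoeff h M N * (x₁ ^ M * y₁ ^ N - x₂ ^ M * y₁ ^ N + x₂ ^ M * y₂ ^ N - x₃ ^ M * y₂ ^ N +
        x₃ ^ M * y₃ ^ N - x₁ ^ M * y₃ ^ N) = 0 := by
    by_cases hMN : biCoeff h M N = 0
    -- Here `M` and `N` carry no information; the hexagon for exponents 2 and 2 is used only for `x
    -- y`.
    · obtain ⟨x₁, x₂, x₃, y₁, y₂, y₃, a, b, c, d, e, k, q, -⟩ :=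
        exists_hexagon_monomial (K := K) le_rfl le_rfl
      exact ⟨x₁, x₂, x₃, y₁, y₂, y₃, a, b, c, d, e, k, q, by rw [hMN, zero_mul]⟩
    · obtain ⟨hM0, hN0⟩ := hmixed M N hMN
      obtain ⟨x₁, x₂, x₃, y₁, y₂, y₃, a, b, c, d, e, k, q, r⟩ :=
        exists_hexagon_monomial (K := K) (show 2 ≤ M by omega) (show 2 ≤ N by omega)
      exact ⟨x₁, x₂, x₃, y₁, y₂, y₃, a, b, c, d, e, k, q, by rw [r, mul_zero]⟩
  obtain ⟨x₁, x₂, x₃, y₁, y₂, y₃, a, b, c, d, e, k, q, r⟩ := hhex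
  refine H.six x₁ x₂ x₃ y₁ y₂ y₃ a b c d e k q ?_
  simp only [hev]
  linear_combination biCoeff h 1 1 * q + r

theorem NoShortCycle.eq_of_mul_id {f : K[X]} (hf : f.Monic) (hf0 : f.eval 0 = 0)
    (hmixed : ∀ i j : ℕ, biCoeff h i j ≠ 0 → 1 ≤ i ∧ 1 ≤ j)
    (H : NoShortCycle (fun x y => f.eval x * y) (fun x y => h.evalEval x y)) :
    ∃ a ζ : K, ζ ≠ 0 ∧
      ((f = rho a ∧
          h = biConst ζ * inX X * inY X + biConst (biCoeff h 2 1) * inX (rho a) * inY X) ∨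
        (f = X ∧ (h = biConst ζ * inX (rho a) * inY X ∨
          h = biConst ζ * inX X * inY (rho a)))) := by
  have hd := H.natDegree_le_two (coeff_zero_eq_zero_of_mixed hmixed)
  rcases hd.eq_or_lt with hd | hd
  · have hrho := eq_rho_of_monic hf hf0 hd
    rw [hrho] at H
    obtain ⟨ζ, hζ, e⟩ := H.eq_of_rho hmixed
    exact ⟨_, ζ, hζ, Or.inl ⟨hrho, e⟩⟩
  · have hX := eq_X_of_monic hf hf0 (by omega)
    rw [hX] at H
    simp only [eval_X] at H
    obtain ⟨a, ζ, hζ, e⟩ := H.eq_of_X hmixed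
    exact ⟨a, ζ, hζ, Or.inr ⟨hX, e⟩⟩

end

/-! ### The listed graphs, and the conclusion. -/

section

variable {F : Type*} [Field F]

theorem gamma3_noShortCycle :
    NoShortCycle (fun x y : F => (inX X * inY X : F[X][Y]).evalEval x y)
      (fun x y : F => (inX (X ^ 2) * inY X : F[X][Y]).evalEval x y) := by
  simp only [evalEval_mul, evalEval_inX, evalEval_inY, eval_X, eval_pow]
  constructor
  · intro x₁ x₂ y₁ y₂ hx hy e _
    exact mul_ne_zero (sub_ne_zero.2 hx) (sub_ne_zero.2 hy) (by linear_combination e)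
  · intro x₁ x₂ x₃ y₁ y₂ y₃ _ hb hc _ hy _ e₁ e₂
    -- Subtracting `x₁ + x₂` times the first sum eliminates `y₁` and leaves `(x₂ - x₃)(x₃ - x₁)(y₂ -
    -- y₃)`.
    exact mul_ne_zero (mul_ne_zero (sub_ne_zero.2 hb) (sub_ne_zero.2 hc.symm))
      (sub_ne_zero.2 hy) (by linear_combination e₂ - (x₁ + x₂) * e₁)

theorem nonempty_iso_gamma3 {f₂ f₃ : F[X][Y]} (α β γ δ : F) (hdet : α * δ - β * γ ≠ 0)
    (h₂ : ∀ x y, f₂.evalEval x y = α * (x * y) + β * (x ^ 2 * y))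
    (h₃ : ∀ x y, f₃.evalEval x y = γ * (x * y) + δ * (x ^ 2 * y)) :
    Nonempty (GammaGraph f₂ f₃ ≃g Gamma3 F) :=
  ⟨(gammaGraphLinearIso α β γ δ hdet (fun x y => by simp [h₂]) (fun x y => by simp [h₃])).symm⟩

/-- The graphs of the classification are isomorphic to `Γ₃`. -/
theorem nonempty_iso_gamma3_of_form {f g : F[X]} {h : F[X][Y]} {a ζ : F} (hζ : ζ ≠ 0)
    (hform : (f = rho a ∧ g = X ∧
        h = biConst ζ * inX X * inY X + biConst (biCoeff h 2 1) * inX (rho a) * inY X) ∨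
      (f = X ∧ g = rho a ∧
        h = biConst ζ * inX X * inY X + biConst (biCoeff h 1 2) * inX X * inY (rho a)) ∨
      (f = X ∧ g = X ∧
        (h = biConst ζ * inX (rho a) * inY X ∨ h = biConst ζ * inX X * inY (rho a)))) :
    Nonempty (GammaGraph (inX f * inY g) h ≃g Gamma3 F) := by
  have hswap : ∀ {f₂ f₃ g₂ g₃ : F[X][Y]}, (∀ x y, f₂.evalEval x y = g₂.evalEval y x) →
      (∀ x y, f₃.evalEval x y = g₃.evalEval y x) →
      Nonempty (GammaGraph g₂ g₃ ≃g Gamma3 F) → Nonempty (GammaGraph f₂ f₃ ≃g Gamma3 F) := by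
    rintro f₂ f₃ g₂ g₃ h₂ h₃ ⟨e⟩
    exact ⟨(gammaGraphSwapIso h₂ h₃).trans e⟩
  rcases hform with ⟨rfl, rfl, e⟩ | ⟨rfl, rfl, e⟩ | ⟨rfl, rfl, e | e⟩
  · generalize biCoeff h 2 1 = c at e
    subst e
    -- These are the coefficients of `ρ_a(x) y` and `h` in the basis `x y`, `x² y`; the determinant
    -- is `-ζ`.
    exact nonempty_iso_gamma3 (-a) 1 (ζ - c * a) c
      (fun e => hζ (by linear_combination -e))
      (fun x y => by simp; ring) (fun x y => by simp; ring)
  · generalize biCoeff h 1 2 = c at e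
    subst e
    apply hswap (fun x y => (evalEval_swap _ y x).symm) (fun x y => (evalEval_swap _ y x).symm)
    exact nonempty_iso_gamma3 (-a) 1 (ζ - c * a) c
      (fun e => hζ (by linear_combination -e))
      (fun x y => by rw [evalEval_swap]; simp; ring) (fun x y => by rw [evalEval_swap]; simp; ring)
  · subst e
    exact nonempty_iso_gamma3 1 0 (-ζ * a) ζ (by simpa using hζ)
      (fun x y => by simp) (fun x y => by simp; ring)
  · subst e
    apply hswap (fun x y => (evalEval_swap _ y x).symm) (fun x y => (evalEval_swap _ y x).symm)
    exact nonempty_iso_gamma3 1 0 (-ζ * a) ζ (by simpa using hζ)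
      (fun x y => by rw [evalEval_swap]; simp; ring) (fun x y => by rw [evalEval_swap]; simp; ring)

end

theorem theorem2 {F : Type*} [Field F] [IsAlgClosed F] [CharZero F]
    (f g : F[X]) (hf : f.Monic) (hg : g.Monic) (hf0 : f.eval 0 = 0) (hg0 : g.eval 0 = 0)
    (h : F[X][Y]) (hne : h ≠ 0)
    (hmixed : ∀ i j : ℕ, biCoeff h i j ≠ 0 → 1 ≤ i ∧ 1 ≤ j) :
    (8 ≤ (GammaGraph (inX f * inY g) h).egirth →
      Nonempty (GammaGraph (inX f * inY g) h ≃g Gamma3 F)) ∧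
    (8 ≤ (GammaGraph (inX f * inY g) h).egirth ↔
      ∃ a ζ : F, ζ ≠ 0 ∧
        ((f = rho a ∧ g = X ∧
            h = biConst ζ * inX X * inY X + biConst (biCoeff h 2 1) * inX (rho a) * inY X) ∨
         (f = X ∧ g = rho a ∧
            h = biConst ζ * inX X * inY X + biConst (biCoeff h 1 2) * inX X * inY (rho a)) ∨
         (f = X ∧ g = X ∧
            (h = biConst ζ * inX (rho a) * inY X ∨ h = biConst ζ * inX X * inY (rho a))))) := by
  have hforms : 8 ≤ (GammaGraph (inX f * inY g) h).egirth → ∃ a ζ : F, ζ ≠ 0 ∧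
        ((f = rho a ∧ g = X ∧
            h = biConst ζ * inX X * inY X + biConst (biCoeff h 2 1) * inX (rho a) * inY X) ∨
         (f = X ∧ g = rho a ∧
            h = biConst ζ * inX X * inY X + biConst (biCoeff h 1 2) * inX X * inY (rho a)) ∨
         (f = X ∧ g = X ∧
            (h = biConst ζ * inX (rho a) * inY X ∨ h = biConst ζ * inX X * inY (rho a)))) := by
    intro hgirth
    have H := noShortCycle_of_le_egirth hgirth
    simp only [evalEval_mul, evalEval_inX, evalEval_inY] at H
    by_cases hgd : g.natDegree ≤ 1
    · have hgX := eq_X_of_monic hg hg0 hgd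
      simp only [hgX, eval_X] at H
      obtain ⟨a, ζ, hζ, ⟨e, e'⟩ | ⟨e, e'⟩⟩ := H.eq_of_mul_id hf hf0 hmixed
      · exact ⟨a, ζ, hζ, Or.inl ⟨e, hgX, e'⟩⟩
      · exact ⟨a, ζ, hζ, Or.inr (Or.inr ⟨e, hgX, e'⟩)⟩
    · have hfX := eq_X_of_monic hf hf0
        ((H.natDegree_le_one_or (coeff_zero_eq_zero_of_mixed hmixed)
          (evalEval_zero_left_of_mixed hmixed)).resolve_right hgd)
      have Hs : NoShortCycle (fun x y => g.eval x * y)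
          (fun x y => (Bivariate.swap h).evalEval x y) := by
        have := H.swap
        simp only [hfX, eval_X] at this
        simpa only [evalEval_swap, mul_comm] using this
      obtain ⟨a, ζ, hζ, ⟨e, e'⟩ | ⟨e, -⟩⟩ := Hs.eq_of_mul_id hg hg0 (mixed_swap hmixed)
      · refine ⟨a, ζ, hζ, Or.inr (Or.inl ⟨hfX, e, ?_⟩)⟩
        rw [biCoeff_swap] at e'
        conv_lhs => rw [← Bivariate.swap_swap_apply h, e']
        simp only [map_add, map_mul, swap_biConst, swap_inX, swap_inY]
        ring
      · exact absurd (by rw [e, natDegree_X]) hgd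
  refine ⟨fun hgirth => ?_, hforms, ?_⟩
  · obtain ⟨a, ζ, hζ, hform⟩ := hforms hgirth
    exact nonempty_iso_gamma3_of_form hζ hform
  · rintro ⟨a, ζ, hζ, hform⟩
    obtain ⟨e⟩ := nonempty_iso_gamma3_of_form hζ hform
    rw [e.egirth_eq]
    exact gamma3_noShortCycle.le_egirth
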